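/- **Setting.** Let $S\ge 1$ and $A\ge 1$ be integers, $\mathcal S=\{1,\dots,S\}$ (contexts), $\mathcal A=\{1,\dots,A\}$ (actions), let $\rho$ be a probability distribution on $\mathcal S$ and let $\eta>0$. A KL-regularized contextual multi-armed bandit instance consists of a mean reward $r:\mathcal S\times\mathcal A\to[0,1]$, a reference policy $\pi^{\mathsf{ref}}$ (a probability distribution $\pi^{\mathsf{ref}}(\cdot\mid s)$ on $\mathcal A$ for every $s$), and, for every $(s,a)$, a $1$-sub-Gaussian noise distribution, i.e. the noise $\varepsilon$ satisfies $\mathbb E\,e^{t\varepsilon}\le e^{t^2/2}$ for all $t\in\mathbb R$. The dataset $\mathcal D=\{(s_i,a_i,r_i)\}_{i=1}^n$ is i.i.d. with $s_i\sim\rho$, $a_i\sim\pi^{\mathsf{ref}}(\cdot\mid s_i)$ and $r_i=r(s_i,a_i)+\varepsilon_i$, where, given $(s_i,a_i)$, $\varepsilon_i$ follows the noise distribution of $(s_i,a_i)$. For a policy $\pi$ put $$J(\pi)=\mathbb E_{s\sim\rho,\,a\sim\pi(\cdot\mid s)}\Big[r(s,a)-\eta^{-1}\log\frac{\pi(a\mid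 s)}{\pi^{\mathsf{ref}}(a\mid s)}\Big]\in[-\infty,\infty),$$ $$\pi^*_r(a\mid s)=\frac{\pi^{\mathsf{ref}}(a\mid s)e^{\eta r(s,a)}}{\sum_{b}\pi^{\mathsf{ref}}(b\mid s)e^{\eta r(s,b)}},\qquad \mathrm{SubOpt}(\pi)=J(\pi^*_r)-J(\pi);$$ $\pi^*_r$ maximizes $J$. For $C^*>0$ let $\mathrm{MAB}(C^*)$ be the class of all instances (with the given $S,A,\eta$) whose concentrability satisfies $\sup_{s,a}\pi^*_r(a\mid s)/\pi^{\mathsf{ref}}(a\mid s)\le C^*$ (with $0/0=0$). An algorithm $\mathtt{Alg}$ maps the dataset $\mathcal D$, possibly with extra randomness, to a policy; it may depend on $S,A,\rho,\eta,C^*,n$ and on $\pi^{\mathsf{ref}}$. **Theorem.** For every constant $K>0$ there is a constant $c>0$, depending only on $K$, such that the following holds. Let $S\ge1$, $A\ge3$ and $n$ be integers, let $\eta>4\log 2$, $C^*\in(2,e^{\eta/4}]$, and let the regularization be large in the sense that $$\eta^2\le K\,\frac{n\log A}{S A C^*}.$$ Then, with $\rho$ the uniform distribution on $\mathcal S$,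 $$\inf_{\mathtt{Alg}}\ \sup_{\mathrm{MAB}(C^*)}\ \mathbb E\big[\mathrm{SubOpt}(\mathtt{Alg}(\mathcal D))\big]\ \ge\ c\,\frac{\eta\,S A C^*}{n\log A},$$ where the supremum is over all instances in $\mathrm{MAB}(C^*)$, including their noise distributions, and the expectation is over the dataset and the randomness of the algorithm. (In particular the same lower bound holds when the supremum also ranges over $\rho$.) -/

import Mathlib

open MeasureTheory ProbabilityTheory
open scoped ENNReal NNReal

noncomputable section

namespace KLBandit

/-- Probability distributions on the set of `S` contexts. -/
abbrev ContextLaw (S : ℕ) : Type := stdSimplex ℝ (Fin S)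

/-- Policies: `π s a` is the probability of playing the action `a` in the context `s`. -/
abbrev Policy (S A : ℕ) : Type := Fin S → stdSimplex ℝ (Fin A)

/-- A dataset of `n` triples (context, action, observed reward). -/
abbrev Dataset (S A n : ℕ) : Type := Fin n → Fin S × Fin A × ℝ

/-- The part of a KL-regularized contextual bandit with `S` contexts and `A` actions that varies
within the class of instances: the mean reward, the reference policy, which is also the behavior
policy, and the law of the reward noise, which is `1`-sub-Gaussian (and hence centered). -/
structure Instance (S A : ℕ) where
  reward : Fin S → Fin A → ℝ
  reward_mem : ∀ s a, reward s a ∈ Set.Icc (0 : ℝ) 1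
  refPolicy : Policy S A
  noise : Fin S → Fin A → ProbabilityMeasure ℝ
  noise_subgaussian : ∀ s a, HasSubgaussianMGF id 1 (noise s a : Measure ℝ)

variable {S A : ℕ}

/-- The normalizing constant `∑ a, πref(a|s) exp (η r(s,a))`. -/
def partitionFn (η : ℝ) (I : Instance S A) (s : Fin S) : ℝ :=
  ∑ a, I.refPolicy s a * Real.exp (η * I.reward s a)

theorem partitionFn_pos (η : ℝ) (I : Instance S A) (s : Fin S) : 0 < partitionFn η I s := by
  have h0 : ∀ a, 0 ≤ I.refPolicy s a := (I.refPolicy s).2.1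
  have h1 : ∑ a, I.refPolicy s a = 1 := (I.refPolicy s).2.2
  have hn : ∀ a ∈ Finset.univ, 0 ≤ I.refPolicy s a * Real.exp (η * I.reward s a) :=
    fun a _ => mul_nonneg (h0 a) (Real.exp_pos _).le
  refine lt_of_le_of_ne (Finset.sum_nonneg hn) fun h => ?_
  have h2 := (Finset.sum_eq_zero_iff_of_nonneg hn).1 h.symm
  have h3 : ∑ a, I.refPolicy s a = 0 := Finset.sum_eq_zero fun a ha =>
    (mul_eq_zero.1 (h2 a ha)).resolve_right (Real.exp_pos _).ne'
  linarith

/-- The optimal policy `π*(a|s) ∝ πref(a|s) exp (η r(s,a))`; it maximizes the objective below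
(`objective_le_optimalPolicy`). -/
def optimalPolicy (η : ℝ) (I : Instance S A) : Policy S A := fun s =>
  ⟨fun a => I.refPolicy s a * Real.exp (η * I.reward s a) / partitionFn η I s,
    fun a => div_nonneg (mul_nonneg ((I.refPolicy s).2.1 a) (Real.exp_pos _).le)
      (partitionFn_pos η I s).le,
    by rw [← Finset.sum_div]; exact div_self (partitionFn_pos η I s).ne'⟩

/-- The concentrability `sup_{s,a} π*(a|s) / πref(a|s)`. Where `πref(a|s) = 0` also
`π*(a|s) = 0`, and the ratio `0 / 0` counts as `0`. -/
def concentrability (η : ℝ) (I : Instance S A) : ℝ :=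
  ⨆ p : Fin S × Fin A, optimalPolicy η I p.1 p.2 / I.refPolicy p.1 p.2

/-- The class of instances with concentrability at most `C`. -/
def MAB (S A : ℕ) (η C : ℝ) : Set (Instance S A) :=
  {I | concentrability η I ≤ C}

open Classical in
/-- The objective `J(π) = E_{s ∼ ρ, a ∼ π(·|s)} [r(s,a) - η⁻¹ log (π(a|s) / πref(a|s))]`. It is
`-∞` as soon as, with positive probability, `π` plays an action that `πref` never plays. -/
def objective (ρ : ContextLaw S) (η : ℝ) (I : Instance S A) (π : Policy S A) : EReal :=
  if ∃ s a, 0 < ρ s * π s a ∧ I.refPolicy s a = 0 then ⊥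
  else ((∑ s, ∑ a, ρ s * π s a *
    (I.reward s a - η⁻¹ * Real.log (π s a / I.refPolicy s a)) : ℝ) : EReal)

/-- The suboptimality gap `J(π*) - J(π)`; `J(π*)` is always finite. -/
def subOpt (ρ : ContextLaw S) (η : ℝ) (I : Instance S A) (π : Policy S A) : EReal :=
  objective ρ η I (optimalPolicy η I) - objective ρ η I π

/-- The law of one observation `(s, a, r(s,a) + ε)`, with `s ∼ ρ`, `a ∼ πref(·|s)` and `ε`
distributed as the noise at `(s, a)`. -/
def sampleLaw (ρ : ContextLaw S) (I : Instance S A) : Measure (Fin S × Fin A × ℝ) :=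
  ∑ s, ∑ a, ENNReal.ofReal (ρ s * I.refPolicy s a) •
    (I.noise s a : Measure ℝ).map fun ε => (s, a, I.reward s a + ε)

instance (ρ : ContextLaw S) (I : Instance S A) : IsProbabilityMeasure (sampleLaw ρ I) := by
  constructor
  have hρ : ∀ s, 0 ≤ ρ s := ρ.2.1
  have hπ : ∀ s a, 0 ≤ I.refPolicy s a := fun s => (I.refPolicy s).2.1
  have h : ∀ s a, ((I.noise s a : Measure ℝ).map fun ε => (s, a, I.reward s a + ε)) Set.univ = 1 := by
    intro s a
    rw [Measure.map_apply (by fun_prop) MeasurableSet.univ]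
    simp
  simp only [sampleLaw, Measure.coe_finsetSum, Finset.sum_apply, Measure.smul_apply, h,
    smul_eq_mul, mul_one]
  have h2 : ∀ s, ∑ a, ENNReal.ofReal (ρ s * I.refPolicy s a) = ENNReal.ofReal (ρ s) := by
    intro s
    rw [← ENNReal.ofReal_sum_of_nonneg fun a _ => mul_nonneg (hρ s) (hπ s a), ← Finset.mul_sum,
      show ∑ a, I.refPolicy s a = 1 from (I.refPolicy s).2.2, mul_one]
  simp only [h2]
  rw [← ENNReal.ofReal_sum_of_nonneg fun s _ => hρ s, show ∑ s, ρ s = 1 from ρ.2.2,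
    ENNReal.ofReal_one]

/-- The law of the i.i.d. dataset of size `n`. -/
def dataLaw (ρ : ContextLaw S) (I : Instance S A) (n : ℕ) : Measure (Dataset S A n) :=
  Measure.pi fun _ => sampleLaw ρ I

/-- An offline learning algorithm. It is told the reference policy `πref`, reads the dataset `D`
and outputs a policy, possibly at random: `output πref D` is the law of its output (a deterministic
algorithm outputs Dirac measures). -/
structure Algorithm (S A n : ℕ) where
  output : Policy S A → Kernel (Dataset S A n) (Policy S A)
  isMarkov : ∀ πref, IsMarkovKernel (output πref)

/-- The expected suboptimality of an algorithm on an instance. The gap is never negative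
(`objective_le_optimalPolicy`), so its passage to `ℝ≥0∞` loses nothing. -/
def risk (ρ : ContextLaw S) (η : ℝ) (I : Instance S A) {n : ℕ} (alg : Algorithm S A n) : ℝ≥0∞ :=
  ∫⁻ D, ∫⁻ π, (subOpt ρ η I π).toENNReal ∂(alg.output I.refPolicy D) ∂(dataLaw ρ I n)

/-- The minimax risk over the class of instances with concentrability at most `C`, when the
contexts are drawn from `ρ`. The algorithm may depend on all of `S, A, ρ, η, C, n`. -/
def minimaxRisk (A : ℕ) (ρ : ContextLaw S) (η C : ℝ) (n : ℕ) : ℝ≥0∞ :=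
  ⨅ alg : Algorithm S A n, ⨆ I ∈ MAB S A η C, risk ρ η I alg

/-- The policy `optimalPolicy` is indeed optimal. -/
theorem objective_le_optimalPolicy (ρ : ContextLaw S) {η : ℝ} (hη : 0 < η) (I : Instance S A)
    (π : Policy S A) : objective ρ η I π ≤ objective ρ η I (optimalPolicy η I) := by
  have hopt : ∀ s a, optimalPolicy η I s a
      = I.refPolicy s a * Real.exp (η * I.reward s a) / partitionFn η I s := fun _ _ => rfl
  have hfin : ¬ ∃ s a, 0 < ρ s * optimalPolicy η I s a ∧ I.refPolicy s a = 0 := by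
    rintro ⟨s, a, h1, h2⟩
    simp [hopt, h2] at h1
  unfold objective
  rw [if_neg hfin]
  split_ifs with h
  · exact bot_le
  push Not at h
  rw [EReal.coe_le_coe_iff]
  refine Finset.sum_le_sum fun s _ => ?_
  simp only [mul_assoc]
  rw [← Finset.mul_sum, ← Finset.mul_sum]
  have hρ : 0 ≤ ρ s := ρ.2.1 s
  rcases hρ.eq_or_lt with h0 | hpos
  · simp [← h0]
  refine mul_le_mul_of_nonneg_left ?_ hρ
  have hZ := partitionFn_pos η I s
  have hq : ∀ a, 0 ≤ I.refPolicy s a := (I.refPolicy s).2.1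
  have hp : ∀ a, 0 ≤ π s a := (π s).2.1
  have hp1 : ∑ a, π s a = 1 := (π s).2.2
  have hg1 : ∑ a, optimalPolicy η I s a = 1 := (optimalPolicy η I s).2.2
  have hL : ∀ a, optimalPolicy η I s a * (I.reward s a
      - η⁻¹ * Real.log (optimalPolicy η I s a / I.refPolicy s a))
      = optimalPolicy η I s a * (η⁻¹ * Real.log (partitionFn η I s)) := by
    intro a
    rcases (hq a).eq_or_lt with hz | hqa
    · simp [hopt, ← hz]
    · have : optimalPolicy η I s a / I.refPolicy s a
          = Real.exp (η * I.reward s a) / partitionFn η I s := by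
        rw [hopt]; field_simp
      rw [this, Real.log_div (Real.exp_pos _).ne' hZ.ne', Real.log_exp]
      field_simp
      ring
  rw [Finset.sum_congr rfl fun a _ => hL a, ← Finset.sum_mul, hg1, one_mul]
  have hR : ∀ a, π s a * (I.reward s a - η⁻¹ * Real.log (π s a / I.refPolicy s a))
      ≤ π s a * (η⁻¹ * Real.log (partitionFn η I s))
        + η⁻¹ * (optimalPolicy η I s a - π s a) := by
    intro a
    rcases (hp a).eq_or_lt with hz | hpa
    · have : 0 ≤ optimalPolicy η I s a := (optimalPolicy η I s).2.1 a
      rw [← hz]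
      have := mul_nonneg (inv_pos.2 hη).le this
      simpa using this
    have hqa : 0 < I.refPolicy s a :=
      lt_of_le_of_ne (hq a) (Ne.symm (h s a (mul_pos hpos hpa)))
    have hga : 0 < optimalPolicy η I s a := by
      rw [hopt]; exact div_pos (mul_pos hqa (Real.exp_pos _)) hZ
    have h1 := Real.log_le_sub_one_of_pos (div_pos hga hpa)
    have h2 : Real.log (optimalPolicy η I s a / π s a) = η * I.reward s a
        - Real.log (π s a / I.refPolicy s a) - Real.log (partitionFn η I s) := by
      rw [Real.log_div hga.ne' hpa.ne', Real.log_div hpa.ne' hqa.ne', hopt,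
        Real.log_div (mul_pos hqa (Real.exp_pos _)).ne' hZ.ne',
        Real.log_mul hqa.ne' (Real.exp_pos _).ne', Real.log_exp]
      ring
    rw [h2] at h1
    have h3 := mul_le_mul_of_nonneg_left h1 (mul_pos (inv_pos.2 hη) hpa).le
    have e1 : η⁻¹ * π s a * (η * I.reward s a - Real.log (π s a / I.refPolicy s a)
        - Real.log (partitionFn η I s)) = π s a * (I.reward s a
        - η⁻¹ * Real.log (π s a / I.refPolicy s a))
        - π s a * (η⁻¹ * Real.log (partitionFn η I s)) := by
      field_simp
    have e2 : η⁻¹ * π s a * (optimalPolicy η I s a / π s a - 1)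
        = η⁻¹ * (optimalPolicy η I s a - π s a) := by
      field_simp
    rw [e1, e2] at h3
    linarith
  refine (Finset.sum_le_sum fun a _ => hR a).trans ?_
  rw [Finset.sum_add_distrib, ← Finset.sum_mul, hp1, ← Finset.mul_sum, Finset.sum_sub_distrib,
    hg1, hp1]
  simp

end KLBandit

end

/-!
The lower bound is an instance of Assouad's method. With `A = m + 1`, the reference policy plays a
base action with probability `1 - 1 / C` and each of the other `m` actions with probability
`1 / (C m)`. The base action has mean reward `0`, every other one the mean reward
`η⁻¹ log (C - 1)` or, if a sign attached to it and to the context says so, `η⁻¹ log (C - 1) + δ`.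
The exponential tilt then lifts the rare actions to a constant share of the optimal policy, their
likelihood ratio being at most `C` as long as `η δ` is small (`signInstance_hard_mem_MAB`).

Two facts are in competition.
* Flipping one sign moves the optimal probability of its action, which is of order `1 / m`, by a
  relative amount of order `η δ` (`separation`). The suboptimality gap is
  `η⁻¹ 𝔼 KL(π ‖ π*)`, hence at least `η⁻¹` times the squared Hellinger distance
  (`ofReal_hellinger_le_subOpt`), which is a sum over contexts and actions. If no sign is known, the
  gap is therefore at least of order `η⁻¹ (η δ) ^ 2 = η δ ^ 2`.
* The observed rewards are signs `±1` with the prescribed means; their noise is `1`-sub-Gaussian by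
  Hoeffding's lemma, and the data range over a finite set. One observation falls on a given rare
  action in a given context with probability `1 / (S C m)`, and only then does it bear on the
  corresponding sign. Hence the Bhattacharyya coefficient of two instances adjacent in this sense is
  at least `1 - δ ^ 2 / (2 S C m)` for one observation, and it stays above `1 / 2` for `n`
  observations if `n δ ^ 2 ≤ S C m` (`half_le_bhattacharyya`).

`assouad` combines the two into the lower bound `η δ ^ 2 / 1536` (`ofReal_le_minimaxRisk`). Taking
`δ ^ 2` to be a small multiple of `S A C / (n log A)` gives the rate. The condition on the data then
holds because `log A ≥ 1`, and `η δ ≤ 1 / 2` is precisely what the assumption of large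
regularization provides. The logarithm is what the range of `η` costs: without it in `δ`, the
product `η δ` could be as large as `√(log A)`.
-/

namespace KLBandit

/-! ### Assouad's method on a finite sample space -/

/-- The sign vector that differs from `v` exactly in the coordinate `i`. -/
def flipAt {ι : Type*} [DecidableEq ι] (i : ι) (v : ι → Bool) : ι → Bool :=
  Function.update v i (!v i)

theorem flipAt_involutive {ι : Type*} [DecidableEq ι] (i : ι) :
    Function.Involutive (flipAt i) := by
  intro v
  simp [flipAt]

theorem sum_add_flipAt {ι : Type*} [Fintype ι] [DecidableEq ι] (i : ι)
    (f : (ι → Bool) → ℝ) : ∑ v, f v = 2⁻¹ * ∑ v, (f v + f (flipAt i v)) := by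
  have h : ∑ v, f (flipAt i v) = ∑ v, f v :=
    Equiv.sum_comp (flipAt_involutive i).toPerm f
  rw [Finset.sum_add_distrib, h]
  ring

/-- No single guess `u` is close to both of two separated targets, so it pays at least the
overlap `min p q` of the two weights times the separation. -/
theorem min_mul_sq_sub_le {p q : ℝ} (hp : 0 ≤ p) (hq : 0 ≤ q) (u α β : ℝ) :
    min p q * ((α - β) ^ 2 / 2) ≤ p * (u - α) ^ 2 + q * (u - β) ^ 2 := by
  have h0 : (α - β) ^ 2 / 2 ≤ (u - α) ^ 2 + (u - β) ^ 2 := by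
    nlinarith [sq_nonneg ((u - α) + (u - β))]
  calc min p q * ((α - β) ^ 2 / 2) ≤ min p q * ((u - α) ^ 2 + (u - β) ^ 2) :=
        mul_le_mul_of_nonneg_left h0 (le_min hp hq)
    _ = min p q * (u - α) ^ 2 + min p q * (u - β) ^ 2 := by ring
    _ ≤ _ := by
        gcongr
        · exact min_le_left _ _
        · exact min_le_right _ _

/-- Le Cam's inequality: the overlap of two probability vectors is at least half the square of
their Bhattacharyya coefficient. -/
theorem sq_sum_sqrt_le_sum_min {X : Type*} [Fintype X] {p q : X → ℝ} (hp : ∀ x, 0 ≤ p x)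
    (hq : ∀ x, 0 ≤ q x) (hp1 : ∑ x, p x = 1) (hq1 : ∑ x, q x = 1) :
    (∑ x, √(p x * q x)) ^ 2 / 2 ≤ ∑ x, min (p x) (q x) := by
  have h1 : (∑ x, √(p x * q x)) ^ 2 ≤ (∑ x, min (p x) (q x)) * ∑ x, max (p x) (q x) := by
    refine Finset.sum_sq_le_sum_mul_sum_of_sq_le_mul _ (fun x _ => le_min (hp x) (hq x))
      (fun x _ => (hp x).trans (le_max_left _ _)) fun x _ => ?_
    rw [Real.sq_sqrt (mul_nonneg (hp x) (hq x)), min_mul_max]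
  have h2 : ∑ x, max (p x) (q x) ≤ 2 := by
    calc ∑ x, max (p x) (q x) ≤ ∑ x, (p x + q x) :=
          Finset.sum_le_sum fun x _ => max_le_add_of_nonneg (hp x) (hq x)
      _ = 2 := by rw [Finset.sum_add_distrib, hp1, hq1]; norm_num
  have h3 : 0 ≤ ∑ x, min (p x) (q x) :=
    Finset.sum_nonneg fun x _ => le_min (hp x) (hq x)
  nlinarith [mul_le_mul_of_nonneg_left h2 h3]

/-- Bhattacharyya coefficients are multiplicative over independent samples. -/
theorem sum_sqrt_prod_mul_prod {X : Type*} [Fintype X] {p q : X → ℝ} (hp : ∀ x, 0 ≤ p x)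
    (hq : ∀ x, 0 ≤ q x) (n : ℕ) :
    ∑ x : Fin n → X, √((∏ i, p (x i)) * ∏ i, q (x i)) = (∑ x, √(p x * q x)) ^ n := by
  rw [Fintype.sum_pow]
  refine Finset.sum_congr rfl fun x _ => ?_
  rw [← Finset.prod_mul_distrib, Real.sqrt_prod _ fun i _ => mul_nonneg (hp _) (hq _)]

theorem sum_min_le_sum_mul_sq {ι : Type*} [Fintype ι] [DecidableEq ι] {p : (ι → Bool) → ℝ}
    (hp : ∀ v, 0 ≤ p v) {α : ι → (ι → Bool) → ℝ} {Δ : ℝ}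
    (hα : ∀ i v, Δ ≤ (α i v - α i (flipAt i v)) ^ 2) (u : ι → ℝ) :
    Δ / 4 * ∑ i, ∑ v, min (p v) (p (flipAt i v)) ≤ ∑ v, p v * ∑ i, (u i - α i v) ^ 2 := by
  simp only [Finset.mul_sum]
  rw [Finset.sum_comm (s := Finset.univ (α := ι → Bool))]
  refine Finset.sum_le_sum fun i _ => ?_
  rw [sum_add_flipAt i fun v => p v * (u i - α i v) ^ 2, Finset.mul_sum]
  refine Finset.sum_le_sum fun v _ => ?_
  have h1 := min_mul_sq_sub_le (hp v) (hp (flipAt i v)) (u i) (α i v) (α i (flipAt i v))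
  have h2 := mul_le_mul_of_nonneg_left (hα i v) (le_min (hp v) (hp (flipAt i v)))
  linarith

/-- Assouad's lemma for the squared loss of a randomized estimator: `P v` is the law of the data
when the parameter is `v`, `κ x` the law of the estimator on the data `x`, and `u i` its guess at
the `i`-th target `α i v`. If flipping one sign moves the corresponding target by at least `√Δ` but
keeps the Bhattacharyya coefficient of the data laws above `h`, then the loss, summed over all
`2 ^ |ι|` parameters, is large. -/
theorem assouad {ι X Ω : Type*} [Fintype ι] [DecidableEq ι] [Fintype X] [MeasurableSpace Ω]
    (κ : X → Measure Ω) [∀ x, IsProbabilityMeasure (κ x)] {u : ι → Ω → ℝ}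
    (hu : ∀ i, Measurable (u i)) {P : (ι → Bool) → X → ℝ} (hP : ∀ v x, 0 ≤ P v x)
    (hP1 : ∀ v, ∑ x, P v x = 1) {α : ι → (ι → Bool) → ℝ} {Δ h : ℝ} (hΔ : 0 ≤ Δ) (hh : 0 ≤ h)
    (hα : ∀ i v, Δ ≤ (α i v - α i (flipAt i v)) ^ 2)
    (hB : ∀ i v, h ≤ ∑ x, √(P v x * P (flipAt i v) x)) :
    ENNReal.ofReal (Fintype.card (ι → Bool) * (Fintype.card ι * (Δ * h ^ 2 / 8)))
      ≤ ∑ v, ∑ x, ENNReal.ofReal (P v x) *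
        ∫⁻ ω, ENNReal.ofReal (∑ i, (u i ω - α i v) ^ 2) ∂κ x := by
  have hm : ∀ v, Measurable fun ω => ∑ i, (u i ω - α i v) ^ 2 := fun v =>
    Finset.measurable_fun_sum _ fun i _ => ((hu i).sub_const _).pow_const 2
  have hG : ∀ x, ENNReal.ofReal (Δ / 4 * ∑ i, ∑ v, min (P v x) (P (flipAt i v) x))
      ≤ ∑ v, ENNReal.ofReal (P v x) *
        ∫⁻ ω, ENNReal.ofReal (∑ i, (u i ω - α i v) ^ 2) ∂κ x := by
    intro x
    have e : ∑ v, ENNReal.ofReal (P v x) *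
        ∫⁻ ω, ENNReal.ofReal (∑ i, (u i ω - α i v) ^ 2) ∂κ x
        = ∫⁻ ω, ENNReal.ofReal (∑ v, P v x * ∑ i, (u i ω - α i v) ^ 2) ∂κ x := by
      simp_rw [← lintegral_const_mul _ (hm _).ennreal_ofReal]
      rw [← lintegral_finsetSum _ fun v _ => ((hm v).ennreal_ofReal.const_mul _)]
      refine lintegral_congr fun ω => ?_
      rw [ENNReal.ofReal_sum_of_nonneg fun v _ =>
        mul_nonneg (hP v x) (Finset.sum_nonneg fun i _ => sq_nonneg _)]
      simp only [ENNReal.ofReal_mul (hP _ x)]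
    rw [e]
    calc _ = ∫⁻ _, ENNReal.ofReal (Δ / 4 * ∑ i, ∑ v, min (P v x) (P (flipAt i v) x)) ∂κ x := by
          simp
      _ ≤ _ := lintegral_mono fun ω => ENNReal.ofReal_le_ofReal
          (sum_min_le_sum_mul_sq (fun v => hP v x) hα fun i => u i ω)
  rw [Finset.sum_comm]
  refine le_trans ?_ (Finset.sum_le_sum fun x _ => hG x)
  have hmin : ∀ i v x, 0 ≤ min (P v x) (P (flipAt i v) x) := fun i v x =>
    le_min (hP v x) (hP _ x)
  rw [← ENNReal.ofReal_sum_of_nonneg fun x _ => mul_nonneg (by positivity)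
    (Finset.sum_nonneg fun i _ => Finset.sum_nonneg fun v _ => hmin i v x)]
  refine ENNReal.ofReal_le_ofReal ?_
  have hov : ∀ i v, h ^ 2 / 2 ≤ ∑ x, min (P v x) (P (flipAt i v) x) := fun i v => by
    have h1 := sq_sum_sqrt_le_sum_min (hP v) (hP (flipAt i v)) (hP1 v) (hP1 _)
    have h2 := pow_le_pow_left₀ hh (hB i v) 2
    linarith
  calc (Fintype.card (ι → Bool) * (Fintype.card ι * (Δ * h ^ 2 / 8)) : ℝ)
      = Δ / 4 * ∑ _i : ι, ∑ _v : ι → Bool, h ^ 2 / 2 := by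
        simp only [Finset.sum_const, Finset.card_univ, nsmul_eq_mul]
        ring
    _ ≤ Δ / 4 * ∑ i, ∑ v, ∑ x, min (P v x) (P (flipAt i v) x) := by
        gcongr
        exact hov _ _
    _ = ∑ x, Δ / 4 * ∑ i, ∑ v, min (P v x) (P (flipAt i v) x) := by
        rw [← Finset.mul_sum, Finset.sum_comm (s := Finset.univ (α := X))]
        congr 1
        refine Finset.sum_congr rfl fun i _ => ?_
        rw [Finset.sum_comm]

/-! ### The suboptimality gap dominates a squared Hellinger distance -/

/-- Pointwise form of the bound of the relative entropy by the squared Hellinger distance. -/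
theorem sq_sub_sqrt_le_mul_log {x y : ℝ} (hx : 0 ≤ x) (hy : 0 < y) :
    (√x - √y) ^ 2 ≤ x * Real.log (x / y) - x + y := by
  rcases hx.eq_or_lt with rfl | hx
  · simp [Real.sq_sqrt hy.le]
  have hsx := Real.sqrt_pos.2 hx
  have hsy := Real.sqrt_pos.2 hy
  have h1 := Real.log_le_sub_one_of_pos (div_pos hsy hsx)
  rw [Real.log_div hsy.ne' hsx.ne', Real.log_sqrt hy.le, Real.log_sqrt hx.le] at h1
  have h2 : x * (√y / √x) = √x * √y := by
    nth_rewrite 1 [← Real.sq_sqrt hx.le]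
    field_simp
  have h3 := mul_le_mul_of_nonneg_left h1 hx.le
  rw [mul_sub x (√y / √x), h2] at h3
  rw [Real.log_div hx.ne' hy.ne', sub_sq, Real.sq_sqrt hx.le, Real.sq_sqrt hy.le]
  linarith

theorem optimalPolicy_pos {S A : ℕ} (η : ℝ) {I : Instance S A} {s : Fin S} {a : Fin A}
    (h : 0 < I.refPolicy s a) : 0 < optimalPolicy η I s a :=
  div_pos (mul_pos h (Real.exp_pos _)) (partitionFn_pos η I s)

/-- The gap is `η⁻¹ 𝔼 KL(π ‖ π*)`, and the relative entropy dominates the squared Hellinger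
distance, which, unlike the relative entropy, splits into nonnegative terms, one for each action. -/
theorem ofReal_hellinger_le_subOpt {S A : ℕ} (ρ : ContextLaw S) {η : ℝ} (hη : 0 < η)
    (I : Instance S A) (hq : ∀ s a, 0 < I.refPolicy s a) (π : Policy S A) :
    ENNReal.ofReal (η⁻¹ * ∑ s, ρ s * ∑ a, (√(π s a) - √(optimalPolicy η I s a)) ^ 2)
      ≤ (subOpt ρ η I π).toENNReal := by
  have hfin : ∀ π : Policy S A, ¬ ∃ s a, 0 < ρ s * π s a ∧ I.refPolicy s a = 0 := by
    rintro π ⟨s, a, -, h⟩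
    exact (hq s a).ne' h
  have hpos : ∀ s a, 0 < optimalPolicy η I s a := fun s a => optimalPolicy_pos η (hq s a)
  have hlog : ∀ s a, Real.log (optimalPolicy η I s a) = Real.log (I.refPolicy s a)
      + η * I.reward s a - Real.log (partitionFn η I s) := by
    intro s a
    change Real.log (I.refPolicy s a * Real.exp (η * I.reward s a) / partitionFn η I s) = _
    rw [Real.log_div (mul_pos (hq s a) (Real.exp_pos _)).ne' (partitionFn_pos η I s).ne',
      Real.log_mul (hq s a).ne' (Real.exp_pos _).ne', Real.log_exp]
  unfold subOpt objective
  rw [if_neg (hfin _), if_neg (hfin _), ← EReal.coe_sub, EReal.real_coe_toENNReal]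
  refine ENNReal.ofReal_le_ofReal ?_
  rw [Finset.mul_sum, ← Finset.sum_sub_distrib]
  refine Finset.sum_le_sum fun s _ => ?_
  have hπ : ∑ a, π s a = 1 := (π s).2.2
  have hπ0 : ∀ a, 0 ≤ π s a := (π s).2.1
  have ho : ∑ a, optimalPolicy η I s a = 1 := (optimalPolicy η I s).2.2
  have hJ : ∑ a, ρ s * optimalPolicy η I s a * (I.reward s a
      - η⁻¹ * Real.log (optimalPolicy η I s a / I.refPolicy s a))
      = ρ s * (η⁻¹ * Real.log (partitionFn η I s)) := by
    have : ∀ a, ρ s * optimalPolicy η I s a * (I.reward s a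
      - η⁻¹ * Real.log (optimalPolicy η I s a / I.refPolicy s a))
      = ρ s * (η⁻¹ * Real.log (partitionFn η I s)) * optimalPolicy η I s a := by
      intro a
      rw [Real.log_div (hpos s a).ne' (hq s a).ne', hlog]
      field_simp
      ring
    rw [Finset.sum_congr rfl fun a _ => this a, ← Finset.mul_sum, ho, mul_one]
  have hterm : ∀ a, π s a * (I.reward s a - η⁻¹ * Real.log (π s a / I.refPolicy s a))
      ≤ π s a * (η⁻¹ * Real.log (partitionFn η I s))
        - η⁻¹ * ((√(π s a) - √(optimalPolicy η I s a)) ^ 2 + π s a - optimalPolicy η I s a) := by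
    intro a
    have h1 := mul_le_mul_of_nonneg_left (sq_sub_sqrt_le_mul_log (hπ0 a) (hpos s a))
      (inv_pos.2 hη).le
    have h2 : η⁻¹ * (π s a * Real.log (π s a / optimalPolicy η I s a))
        = π s a * (η⁻¹ * Real.log (partitionFn η I s))
          - π s a * (I.reward s a - η⁻¹ * Real.log (π s a / I.refPolicy s a)) := by
      rcases (hπ0 a).eq_or_lt with h0 | h0
      · simp [← h0]
      rw [Real.log_div h0.ne' (hpos s a).ne', Real.log_div h0.ne' (hq s a).ne', hlog]
      field_simp
      ring
    rw [mul_add, mul_sub, h2] at h1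
    linarith
  have hsum := Finset.sum_le_sum fun a (_ : a ∈ Finset.univ) => hterm a
  rw [Finset.sum_sub_distrib, ← Finset.sum_mul, hπ, ← Finset.mul_sum, Finset.sum_sub_distrib,
    Finset.sum_add_distrib, hπ, ho] at hsum
  have hρ : 0 ≤ ρ s := ρ.2.1 s
  have h := mul_le_mul_of_nonneg_left hsum hρ
  rw [hJ]
  simp only [mul_assoc]
  rw [← Finset.mul_sum]
  linarith

/-! ### Bandits with observations in `{-1, 1}` -/

/-- The law of the noise of an observation with mean `r` that takes only the values `1` and `-1`. -/
noncomputable def signNoise (r : ℝ) : Measure ℝ :=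
  ENNReal.ofReal ((1 + r) / 2) • Measure.dirac (1 - r)
    + ENNReal.ofReal ((1 - r) / 2) • Measure.dirac (-1 - r)

theorem isProbabilityMeasure_signNoise {r : ℝ} (hr : r ∈ Set.Icc (0 : ℝ) 1) :
    IsProbabilityMeasure (signNoise r) := by
  constructor
  simp only [signNoise, Measure.add_apply, Measure.smul_apply, measure_univ, smul_eq_mul, mul_one]
  rw [← ENNReal.ofReal_add (by linarith [hr.1]) (by linarith [hr.2]), ← ENNReal.ofReal_one]
  congr 1
  ring

/-- The noise is centered and takes values in an interval of length `2`, so that Hoeffding's lemma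
applies. -/
theorem hasSubgaussianMGF_signNoise {r : ℝ} (hr : r ∈ Set.Icc (0 : ℝ) 1) :
    HasSubgaussianMGF id 1 (signNoise r) := by
  have := isProbabilityMeasure_signNoise hr
  have h := hasSubgaussianMGF_of_mem_Icc_of_integral_eq_zero (μ := signNoise r) (X := id)
    (a := -1 - r) (b := 1 - r) measurable_id.aemeasurable ?_ ?_
  · convert h
    rw [show (1 - r - (-1 - r) : ℝ) = 2 by ring]
    ext
    norm_num
  · refine ae_add_measure_iff.2 ⟨?_, ?_⟩
    · refine Measure.ae_smul_measure ?_ _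
      rw [ae_dirac_eq]
      exact ⟨by simp only [id]; linarith, le_rfl⟩
    · refine Measure.ae_smul_measure ?_ _
      rw [ae_dirac_eq]
      exact ⟨le_rfl, by simp only [id]; linarith⟩
  · have hi : ∀ (c : ℝ) (x : ℝ), Integrable id (ENNReal.ofReal c • Measure.dirac x) :=
      fun c x => (integrable_dirac (by simp [enorm])).smul_measure ENNReal.ofReal_ne_top
    rw [signNoise, integral_add_measure (hi _ _) (hi _ _), integral_smul_measure,
      integral_smul_measure, integral_dirac, integral_dirac,
      ENNReal.toReal_ofReal (by linarith [hr.1]), ENNReal.toReal_ofReal (by linarith [hr.2])]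
    simp only [id, smul_eq_mul]
    ring

/-- The observation `1` or `-1` encoded by a Boolean. -/
noncomputable def signOf (b : Bool) : ℝ := if b then 1 else -1

theorem signOf_injective : Function.Injective signOf := by
  intro b c
  cases b <;> cases c <;> norm_num [signOf]

/-- The probability of the observation `signOf b` when the mean is `r`. -/
noncomputable def signProb (r : ℝ) (b : Bool) : ℝ := if b then (1 + r) / 2 else (1 - r) / 2

theorem signProb_nonneg {r : ℝ} (hr : r ∈ Set.Icc (0 : ℝ) 1) (b : Bool) : 0 ≤ signProb r b := by
  cases b <;> simp only [signProb] <;> norm_num <;> linarith [hr.1, hr.2]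

theorem sum_signProb (r : ℝ) : ∑ b, signProb r b = 1 := by
  simp [signProb]
  ring

theorem ofReal_signProb_le_signNoise (r : ℝ) (b : Bool) :
    ENNReal.ofReal (signProb r b) ≤ signNoise r {signOf b - r} := by
  cases b <;> simp [signProb, signOf, signNoise]

variable {S A m : ℕ}

/-- The bandit with the given mean rewards and reference policy whose observations are signs. -/
noncomputable def signInstance (q : Policy S A) (r : Fin S → Fin A → ℝ)
    (hr : ∀ s a, r s a ∈ Set.Icc (0 : ℝ) 1) : Instance S A where
  reward := r
  reward_mem := hr
  refPolicy := q
  noise s a := ⟨signNoise (r s a), isProbabilityMeasure_signNoise (hr s a)⟩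
  noise_subgaussian s a := hasSubgaussianMGF_signNoise (hr s a)

/-- The probability of one observation in `signInstance`. -/
noncomputable def signWeight (ρ : ContextLaw S) (q : Policy S A) (r : Fin S → Fin A → ℝ)
    (x : Fin S × Fin A × Bool) : ℝ :=
  ρ x.1 * q x.1 x.2.1 * signProb (r x.1 x.2.1) x.2.2

theorem signWeight_nonneg (ρ : ContextLaw S) (q : Policy S A) {r : Fin S → Fin A → ℝ}
    (hr : ∀ s a, r s a ∈ Set.Icc (0 : ℝ) 1) (x : Fin S × Fin A × Bool) :
    0 ≤ signWeight ρ q r x :=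
  mul_nonneg (mul_nonneg (ρ.2.1 _) ((q _).2.1 _)) (signProb_nonneg (hr _ _) _)

theorem sum_context_mul_policy (ρ : ContextLaw S) (q : Policy S A) :
    ∑ s, ∑ a, ρ s * q s a = 1 := by
  have h : ∀ s, ∑ a, q s a = 1 := fun s => (q s).2.2
  simp only [← Finset.mul_sum, h, mul_one]
  exact ρ.2.2

theorem sum_signWeight (ρ : ContextLaw S) (q : Policy S A) (r : Fin S → Fin A → ℝ) :
    ∑ x, signWeight ρ q r x = 1 := by
  simp only [signWeight, Fintype.sum_prod_type, ← Finset.mul_sum, sum_signProb, mul_one]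
  simpa only [Finset.mul_sum] using sum_context_mul_policy ρ q

/-- The data point encoded by a context, an action and a sign. -/
noncomputable def decode (x : Fin S × Fin A × Bool) : Fin S × Fin A × ℝ :=
  (x.1, x.2.1, signOf x.2.2)

theorem decode_injective : Function.Injective (decode (S := S) (A := A)) := by
  rintro ⟨s, a, b⟩ ⟨s', a', b'⟩ h
  simp only [decode, Prod.mk.injEq] at h
  rw [h.1, h.2.1, signOf_injective h.2.2]

theorem ofReal_signWeight_le_sampleLaw (ρ : ContextLaw S) (q : Policy S A)
    {r : Fin S → Fin A → ℝ} (hr : ∀ s a, r s a ∈ Set.Icc (0 : ℝ) 1)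
    (x : Fin S × Fin A × Bool) :
    ENNReal.ofReal (signWeight ρ q r x) ≤ sampleLaw ρ (signInstance q r hr) {decode x} := by
  obtain ⟨s, a, b⟩ := x
  have hpre : (fun ε => (s, a, r s a + ε)) ⁻¹' {decode (s, a, b)} = {signOf b - r s a} := by
    ext ε
    simp only [decode, Set.mem_preimage, Set.mem_singleton_iff, Prod.mk.injEq, true_and]
    constructor <;> intro h <;> linarith
  have h1 : ENNReal.ofReal (signWeight ρ q r (s, a, b)) ≤ ENNReal.ofReal (ρ s * q s a)
      * ((signNoise (r s a)).map fun ε => (s, a, r s a + ε)) {decode (s, a, b)} := by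
    rw [Measure.map_apply (by fun_prop) (measurableSet_singleton _), hpre]
    simp only [signWeight]
    have h0 : 0 ≤ ρ s * q s a := mul_nonneg (ρ.2.1 _) ((q _).2.1 _)
    rw [ENNReal.ofReal_mul h0]
    gcongr
    exact ofReal_signProb_le_signNoise _ _
  refine h1.trans ?_
  simp only [sampleLaw, Measure.coe_finsetSum, Finset.sum_apply, Measure.smul_apply, smul_eq_mul]
  let f : Fin S → Fin A → ℝ≥0∞ := fun s' a' => ENNReal.ofReal (ρ s' * q s' a') *
    ((signNoise (r s' a')).map fun ε => (s', a', r s' a' + ε)) {decode (s, a, b)}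
  exact (Finset.single_le_sum (f := f s) (fun _ _ => zero_le) (Finset.mem_univ a)).trans
    (Finset.single_le_sum (f := fun s' => ∑ a', f s' a') (fun _ _ => zero_le) (Finset.mem_univ s))

/-- The risk, restricted to the finitely many datasets of signs. -/
theorem sum_le_risk_signInstance (ρ : ContextLaw S) (q : Policy S A) {r : Fin S → Fin A → ℝ}
    (hr : ∀ s a, r s a ∈ Set.Icc (0 : ℝ) 1) (η : ℝ) {n : ℕ} (alg : Algorithm S A n) :
    ∑ x : Fin n → Fin S × Fin A × Bool, ENNReal.ofReal (∏ i, signWeight ρ q r (x i)) *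
        ∫⁻ π, (subOpt ρ η (signInstance q r hr) π).toENNReal ∂alg.output q (decode ∘ x)
      ≤ risk ρ η (signInstance q r hr) alg := by
  classical
  let t : Finset (Dataset S A n) := Finset.univ.image fun x => decode ∘ x
  refine le_trans ?_ (setLIntegral_le_lintegral (t : Set (Dataset S A n)) _)
  rw [lintegral_finset, Finset.sum_image fun x _ y _ h => decode_injective.comp_left h]
  refine Finset.sum_le_sum fun x _ => ?_
  rw [mul_comm, dataLaw, Measure.pi_singleton,
    ENNReal.ofReal_prod_of_nonneg fun i _ => signWeight_nonneg ρ q hr (x i)]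
  exact mul_le_mul_right
    (Finset.prod_le_prod' fun i _ => ofReal_signWeight_le_sampleLaw ρ q hr (x i)) _

/-! ### Closeness of two instances that differ in one mean reward -/

/-- The geometric mean dominates the harmonic mean, which is the arithmetic mean minus a square
over twice the sum. -/
theorem sqrt_mul_ge_sub {p q : ℝ} (hp : 0 < p) (hq : 0 < q) :
    (p + q) / 2 - (p - q) ^ 2 / (2 * (p + q)) ≤ √(p * q) := by
  have hpq : 0 < p + q := by linarith
  have e : (p + q) / 2 - (p - q) ^ 2 / (2 * (p + q)) = 2 * (p * q) / (p + q) := by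
    field_simp
    ring
  rw [e, div_le_iff₀ hpq]
  have h1 := Real.mul_self_sqrt (mul_pos hp hq).le
  have h2 : 2 * √(p * q) ≤ p + q := by
    rw [Real.sqrt_mul hp.le]
    nlinarith [sq_nonneg (√p - √q), Real.sq_sqrt hp.le, Real.sq_sqrt hq.le]
  nlinarith [Real.sqrt_nonneg (p * q)]

theorem one_sub_sq_le_sum_sqrt_signProb {r r' : ℝ} (hr : r ∈ Set.Icc (0 : ℝ) (1 / 2))
    (hr' : r' ∈ Set.Icc (0 : ℝ) (1 / 2)) :
    1 - (r - r') ^ 2 / 2 ≤ ∑ b, √(signProb r b * signProb r' b) := by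
  obtain ⟨h0, h1⟩ := hr
  obtain ⟨h0', h1'⟩ := hr'
  have ht := sqrt_mul_ge_sub (p := (1 + r) / 2) (q := (1 + r') / 2) (by linarith) (by linarith)
  have hf := sqrt_mul_ge_sub (p := (1 - r) / 2) (q := (1 - r') / 2) (by linarith) (by linarith)
  have bt : ((1 + r) / 2 - (1 + r') / 2) ^ 2 / (2 * ((1 + r) / 2 + (1 + r') / 2))
      ≤ (r - r') ^ 2 / 4 := by
    rw [div_le_iff₀ (by linarith)]
    nlinarith [sq_nonneg (r - r'), mul_nonneg (sq_nonneg (r - r')) (add_nonneg h0 h0')]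
  have bf : ((1 - r) / 2 - (1 - r') / 2) ^ 2 / (2 * ((1 - r) / 2 + (1 - r') / 2))
      ≤ (r - r') ^ 2 / 4 := by
    rw [div_le_iff₀ (by linarith)]
    nlinarith [mul_nonneg (sq_nonneg (r - r'))
      (by linarith : 0 ≤ 1 - r - r')]
  simp only [signProb, Fintype.sum_bool, if_true, Bool.false_eq_true, if_false]
  linarith

/-- Each observation distinguishes the two instances only if it falls on the context and action at
which they differ. -/
theorem one_sub_le_sum_sqrt_signWeight (ρ : ContextLaw S) (q : Policy S A)
    {r r' : Fin S → Fin A → ℝ} (hr : ∀ s a, r s a ∈ Set.Icc (0 : ℝ) (1 / 2))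
    (hr' : ∀ s a, r' s a ∈ Set.Icc (0 : ℝ) (1 / 2)) {s₀ : Fin S} {a₀ : Fin A}
    (h : ∀ s a, (s, a) ≠ (s₀, a₀) → r s a = r' s a) :
    1 - ρ s₀ * q s₀ a₀ * ((r s₀ a₀ - r' s₀ a₀) ^ 2 / 2)
      ≤ ∑ x, √(signWeight ρ q r x * signWeight ρ q r' x) := by
  have hw : ∀ s a, 0 ≤ ρ s * q s a := fun s a => mul_nonneg (ρ.2.1 _) ((q _).2.1 _)
  have e : ∑ x, √(signWeight ρ q r x * signWeight ρ q r' x) = ∑ p : Fin S × Fin A,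
      ρ p.1 * q p.1 p.2 * ∑ b, √(signProb (r p.1 p.2) b * signProb (r' p.1 p.2) b) := by
    simp only [signWeight, Fintype.sum_prod_type, Finset.mul_sum]
    refine Finset.sum_congr rfl fun s _ => Finset.sum_congr rfl fun a _ =>
      Finset.sum_congr rfl fun b _ => ?_
    rw [mul_mul_mul_comm, Real.sqrt_mul (mul_self_nonneg _), Real.sqrt_mul_self (hw s a)]
  have hone : ∑ p : Fin S × Fin A, ρ p.1 * q p.1 p.2 = 1 := by
    rw [Fintype.sum_prod_type]
    exact sum_context_mul_policy ρ q
  have hz : ∑ p : Fin S × Fin A, ρ p.1 * q p.1 p.2 * ((r p.1 p.2 - r' p.1 p.2) ^ 2 / 2)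
      = ρ s₀ * q s₀ a₀ * ((r s₀ a₀ - r' s₀ a₀) ^ 2 / 2) := by
    refine Fintype.sum_eq_single (s₀, a₀) fun p hp => ?_
    rw [h p.1 p.2 hp]
    simp
  rw [e, ← hz]
  nth_rewrite 1 [← hone]
  rw [← Finset.sum_sub_distrib]
  refine Finset.sum_le_sum fun p _ => ?_
  have := mul_le_mul_of_nonneg_left
    (one_sub_sq_le_sum_sqrt_signProb (hr p.1 p.2) (hr' p.1 p.2)) (hw p.1 p.2)
  linarith

/-! ### The hard family of instances -/

/-- The reference policy of the hard family: the base action `0` has probability `1 - 1 / C`, and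
the remaining `m` actions share the mass `1 / C` equally. -/
noncomputable def hardRef (S : ℕ) (C : ℝ) (hm : 0 < m) (hC : 1 ≤ C) : Policy S (m + 1) := fun _ =>
  ⟨Fin.cons (1 - 1 / C) fun _ => 1 / (C * m), by
    have hC0 : 0 < C := by linarith
    refine ⟨fun a => ?_, ?_⟩
    · refine Fin.cases ?_ (fun j => ?_) a
      · have : 1 / C ≤ 1 := by rw [div_le_one hC0]; exact hC
        simp only [Fin.cons_zero]
        linarith
      · simp only [Fin.cons_succ]
        positivity
    · have : (m : ℝ) ≠ 0 := by positivity
      simp only [Fin.sum_univ_succ, Fin.cons_zero, Fin.cons_succ, Finset.sum_const,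
        Finset.card_univ, Fintype.card_fin, nsmul_eq_mul]
      field_simp
      ring⟩

/-- The mean rewards of the hard family: `0` for the base action, and `b` or `b + δ` for every other
action, as prescribed by the sign vector `v`. -/
noncomputable def hardReward (b δ : ℝ) (v : Fin S × Fin m → Bool) (s : Fin S) :
    Fin (m + 1) → ℝ :=
  Fin.cons 0 fun j => b + if v (s, j) then δ else 0

theorem hardRef_zero {C : ℝ} (hm : 0 < m) (hC : 1 ≤ C) (s : Fin S) :
    hardRef S C hm hC s 0 = 1 - 1 / C := rfl

theorem hardRef_succ {C : ℝ} (hm : 0 < m) (hC : 1 ≤ C) (s : Fin S) (j : Fin m) :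
    hardRef S C hm hC s j.succ = 1 / (C * m) := rfl

@[simp] theorem hardReward_zero (b δ : ℝ) (v : Fin S × Fin m → Bool) (s : Fin S) :
    hardReward b δ v s 0 = 0 := rfl

@[simp] theorem hardReward_succ (b δ : ℝ) (v : Fin S × Fin m → Bool) (s : Fin S) (j : Fin m) :
    hardReward b δ v s j.succ = b + if v (s, j) then δ else 0 := rfl

theorem hardRef_pos {C : ℝ} (hm : 0 < m) (hC : 1 < C) (s : Fin S) (a : Fin (m + 1)) :
    0 < hardRef S C hm hC.le s a := by
  have hC0 : 0 < C := by linarith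
  refine Fin.cases ?_ (fun j => ?_) a
  · rw [hardRef_zero, sub_pos, div_lt_one hC0]
    exact hC
  · rw [hardRef_succ]
    positivity

theorem hardReward_mem {b δ : ℝ} (hb : b ∈ Set.Icc (0 : ℝ) (1 / 4))
    (hδ : δ ∈ Set.Icc (0 : ℝ) (1 / 4)) (v : Fin S × Fin m → Bool) (s : Fin S)
    (a : Fin (m + 1)) : hardReward b δ v s a ∈ Set.Icc (0 : ℝ) (1 / 2) := by
  obtain ⟨hb0, hb1⟩ := hb
  obtain ⟨hδ0, hδ1⟩ := hδ
  refine Fin.cases ?_ (fun j => ?_) a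
  · rw [hardReward_zero]
    norm_num
  · rw [hardReward_succ]
    split_ifs
    · exact ⟨by linarith, by linarith⟩
    · exact ⟨by linarith, by linarith⟩

/-- The factor by which a sign changes the weight of an action in the optimal policy. -/
noncomputable def gain (β : ℝ) (c : Bool) : ℝ := if c then Real.exp β else 1

theorem gain_mem {β : ℝ} (h0 : 0 ≤ β) (h1 : β ≤ 1 / 2) (c : Bool) :
    gain β c ∈ Set.Icc (1 : ℝ) 2 := by
  have hle : 1 ≤ Real.exp β := Real.one_le_exp h0
  have hlt : Real.exp β ≤ 2 := by
    rw [← Real.le_log_iff_exp_le two_pos]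
    linarith [Real.log_two_gt_d9]
  cases c
  · norm_num [gain]
  · exact ⟨by simpa [gain] using hle, by simpa [gain] using hlt⟩

theorem exp_mul_hardReward_succ {η b δ C : ℝ} (hC : 1 < C) (hb : η * b = Real.log (C - 1))
    (v : Fin S × Fin m → Bool) (s : Fin S) (j : Fin m) :
    Real.exp (η * hardReward b δ v s j.succ) = (C - 1) * gain (η * δ) (v (s, j)) := by
  rw [hardReward_succ, mul_add, hb, Real.exp_add, Real.exp_log (by linarith)]
  cases v (s, j) <;> simp [gain]

/-- The total weight of a context: `m` for the base action and a `gain` for every other one. -/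
noncomputable def totalGain (β : ℝ) (v : Fin S × Fin m → Bool) (s : Fin S) : ℝ :=
  m + ∑ j, gain β (v (s, j))

theorem totalGain_mem {β : ℝ} (h0 : 0 ≤ β) (h1 : β ≤ 1 / 2) (v : Fin S × Fin m → Bool)
    (s : Fin S) : totalGain β v s ∈ Set.Icc (2 * m : ℝ) (3 * m) := by
  have hl : ∑ _j : Fin m, (1 : ℝ) ≤ ∑ j, gain β (v (s, j)) :=
    Finset.sum_le_sum fun j _ => (gain_mem h0 h1 _).1
  have hu : ∑ j, gain β (v (s, j)) ≤ ∑ _j : Fin m, (2 : ℝ) :=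
    Finset.sum_le_sum fun j _ => (gain_mem h0 h1 _).2
  simp only [Finset.sum_const, Finset.card_univ, Fintype.card_fin, nsmul_eq_mul] at hl hu
  exact ⟨by unfold totalGain; linarith, by unfold totalGain; linarith⟩

theorem partitionFn_hard {η b δ C : ℝ} (hm : 0 < m) (hC : 2 ≤ C) (hb : η * b = Real.log (C - 1))
    (v : Fin S × Fin m → Bool) (hr : ∀ s a, hardReward b δ v s a ∈ Set.Icc (0 : ℝ) 1)
    (s : Fin S) :
    partitionFn η (signInstance (hardRef S C hm (by linarith)) (hardReward b δ v) hr) s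
      = (1 - 1 / C) / m * totalGain (η * δ) v s := by
  have hC0 : C ≠ 0 := by linarith
  have hm0 : (m : ℝ) ≠ 0 := by positivity
  change ∑ a, hardRef S C hm (by linarith) s a * Real.exp (η * hardReward b δ v s a) = _
  simp only [Fin.sum_univ_succ, hardRef_zero, hardRef_succ, hardReward_zero,
    exp_mul_hardReward_succ (by linarith : 1 < C) hb, totalGain]
  rw [← Finset.mul_sum, ← Finset.mul_sum]
  simp only [mul_zero, Real.exp_zero]
  field_simp

theorem optimalPolicy_hard_succ {η b δ C : ℝ} (hm : 0 < m) (hC : 2 ≤ C)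
    (hb : η * b = Real.log (C - 1))
    (v : Fin S × Fin m → Bool) (hr : ∀ s a, hardReward b δ v s a ∈ Set.Icc (0 : ℝ) 1)
    (s : Fin S) (j : Fin m) :
    optimalPolicy η (signInstance (hardRef S C hm (by linarith)) (hardReward b δ v) hr) s j.succ
      = gain (η * δ) (v (s, j)) / totalGain (η * δ) v s := by
  have hC0 : C ≠ 0 := by linarith
  have hC1 : C - 1 ≠ 0 := by linarith
  have hm0 : (m : ℝ) ≠ 0 := by positivity
  change hardRef S C hm (by linarith) s j.succ * Real.exp (η * hardReward b δ v s j.succ)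
    / partitionFn η _ s = _
  rw [partitionFn_hard hm hC hb, hardRef_succ, exp_mul_hardReward_succ (by linarith : 1 < C) hb]
  field_simp

theorem signInstance_hard_mem_MAB {η b δ C : ℝ} (hm : 0 < m) (hC : 2 ≤ C)
    (hb : η * b = Real.log (C - 1))
    (v : Fin S × Fin m → Bool) (hr : ∀ s a, hardReward b δ v s a ∈ Set.Icc (0 : ℝ) 1)
    (h0 : 0 ≤ η * δ) (h1 : η * δ ≤ 1 / 2) :
    signInstance (hardRef S C hm (by linarith)) (hardReward b δ v) hr ∈ MAB S (m + 1) η C := by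
  have hC0 : 0 < C := by linarith
  have hm0 : (0 : ℝ) < m := by positivity
  refine Real.iSup_le (fun ⟨s, a⟩ => ?_) hC0.le
  obtain ⟨hT, -⟩ := totalGain_mem h0 h1 v s
  have hT0 : 0 < totalGain (η * δ) v s := by linarith
  -- The ratio is `1 / Z` for the base action and `C * gain * m / totalGain` for the others, where
  -- `gain * m ≤ 2 * m ≤ totalGain`.
  refine Fin.cases ?_ (fun j => ?_) a
  · have hq : 0 < 1 - 1 / C := by
      rw [sub_pos, div_lt_one hC0]
      linarith
    change hardRef S C hm (by linarith) s 0 * Real.exp (η * hardReward b δ v s 0)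
      / partitionFn η _ s / hardRef S C hm (by linarith) s 0 ≤ C
    rw [partitionFn_hard hm hC hb, hardRef_zero, hardReward_zero, mul_zero, Real.exp_zero, mul_one,
      div_div, mul_comm, ← div_div, div_self hq.ne', div_le_iff₀ (by positivity)]
    have e : C * ((1 - 1 / C) / m * totalGain (η * δ) v s)
        = (C - 1) * (totalGain (η * δ) v s / m) := by
      field_simp
    have h2 : 1 ≤ totalGain (η * δ) v s / m := by
      rw [le_div_iff₀ hm0]
      linarith
    rw [e]
    nlinarith
  · simp only []
    rw [optimalPolicy_hard_succ hm hC hb]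
    change gain (η * δ) (v (s, j)) / totalGain (η * δ) v s
      / hardRef S C hm (by linarith) s j.succ ≤ C
    rw [hardRef_succ]
    have e : gain (η * δ) (v (s, j)) / totalGain (η * δ) v s / (1 / (C * m))
        = C * (gain (η * δ) (v (s, j)) * m / totalGain (η * δ) v s) := by
      field_simp
    have h2 : gain (η * δ) (v (s, j)) * m / totalGain (η * δ) v s ≤ 1 := by
      rw [div_le_one hT0]
      nlinarith [(gain_mem h0 h1 (v (s, j))).2]
    rw [e]
    nlinarith

/-! ### Separation of the optimal policies -/

theorem sq_sub_div_le_sq_sub_sqrt {x y : ℝ} (hx : 0 < x) (hy : 0 < y) :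
    (x - y) ^ 2 / (2 * (x + y)) ≤ (√x - √y) ^ 2 := by
  rw [div_le_iff₀ (by linarith)]
  have hx' := Real.sq_sqrt hx.le
  have hy' := Real.sq_sqrt hy.le
  have e : (x - y) ^ 2 = (√x - √y) ^ 2 * (√x + √y) ^ 2 := by
    nth_rewrite 1 [← hx', ← hy']
    ring
  rw [e]
  refine mul_le_mul_of_nonneg_left ?_ (sq_nonneg _)
  nlinarith [sq_nonneg (√x - √y)]

theorem sq_div_le_sq_sub_sqrt {T t β M : ℝ} (hM : 2 ≤ M) (hT : 2 * M ≤ T) (hTt : T + t ≤ 3 * M)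
    (hβ : 0 ≤ β) (hβt : β ≤ t) (ht : t ≤ 1) :
    β ^ 2 / (48 * M) ≤ (√(1 / T) - √((1 + t) / (T + t))) ^ 2 := by
  have hT0 : 0 < T := by linarith
  have hTt0 : 0 < T + t := by linarith
  have hM0 : 0 < M := by linarith
  have hsum0 : 0 < 1 / T + (1 + t) / (T + t) :=
    add_pos (by positivity) (div_pos (by linarith) hTt0)
  refine le_trans ?_ (sq_sub_div_le_sq_sub_sqrt (x := 1 / T) (y := (1 + t) / (T + t))
    (by positivity) (div_pos (by linarith) hTt0))
  have hdiff : β / (4 * M) ≤ (1 + t) / (T + t) - 1 / T := by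
    have e : (1 + t) / (T + t) - 1 / T = t * (1 - 1 / T) / (T + t) := by
      field_simp
      ring
    have h1 : 1 / T ≤ 1 / 4 := one_div_le_one_div_of_le (by norm_num) (by linarith)
    rw [e, div_le_div_iff₀ (by positivity) hTt0]
    have h2 : β * (3 / 4) ≤ t * (1 - 1 / T) :=
      mul_le_mul hβt (by linarith) (by norm_num) (by linarith)
    calc β * (T + t) ≤ β * (3 * M) := mul_le_mul_of_nonneg_left hTt hβ
      _ = β * (3 / 4) * (4 * M) := by ring
      _ ≤ _ := mul_le_mul_of_nonneg_right h2 (by positivity)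
  have hsum : 1 / T + (1 + t) / (T + t) ≤ 3 / (2 * M) := by
    have h1 : 1 / T ≤ 1 / (2 * M) := one_div_le_one_div_of_le (by positivity) hT
    have h2 : (1 + t) / (T + t) ≤ 2 / (2 * M) :=
      div_le_div₀ (by norm_num) (by linarith) (by positivity) (by linarith)
    calc _ ≤ 1 / (2 * M) + 2 / (2 * M) := add_le_add h1 h2
      _ = _ := by ring
  have hsq : (β / (4 * M)) ^ 2 ≤ (1 / T - (1 + t) / (T + t)) ^ 2 := by
    rw [← neg_sub, neg_sq]
    exact pow_le_pow_left₀ (by positivity) hdiff 2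
  calc β ^ 2 / (48 * M) = (β / (4 * M)) ^ 2 / (2 * (3 / (2 * M))) := by
        field_simp
        ring
    _ ≤ _ := div_le_div₀ (sq_nonneg _) hsq (by linarith) (by linarith)

theorem totalGain_flipAt {β : ℝ} {v : Fin S × Fin m → Bool} {s : Fin S} {j : Fin m}
    (h : v (s, j) = false) :
    totalGain β (flipAt (s, j) v) s = totalGain β v s + (Real.exp β - 1) := by
  have hs : ∀ j', gain β (flipAt (s, j) v (s, j'))
      = gain β (v (s, j')) + if j' = j then Real.exp β - 1 else 0 := by
    intro j'
    by_cases hj : j' = j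
    · subst hj
      simp [flipAt, h, gain]
    · simp [flipAt, hj]
  simp only [totalGain, hs, Finset.sum_add_distrib, Finset.sum_ite_eq', Finset.mem_univ, if_true]
  ring

/-- Flipping the sign of an action moves the square root of its optimal probability by at least a
multiple of `β / √m`, although the normalization moves as well. -/
theorem separation {β : ℝ} (h0 : 0 ≤ β) (h1 : β ≤ 1 / 2) (hm : 2 ≤ m) (i : Fin S × Fin m)
    (v : Fin S × Fin m → Bool) :
    β ^ 2 / (48 * m) ≤ (√(gain β (v i) / totalGain β v i.1)
      - √(gain β (flipAt i v i) / totalGain β (flipAt i v) i.1)) ^ 2 := by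
  have key : ∀ v : Fin S × Fin m → Bool, v i = false →
      β ^ 2 / (48 * m) ≤ (√(gain β (v i) / totalGain β v i.1)
      - √(gain β (flipAt i v i) / totalGain β (flipAt i v) i.1)) ^ 2 := by
    intro v hv
    -- With the sign off, the optimal probability is `1 / T`; switching it on adds `exp β - 1` to
    -- both the numerator and the denominator.
    obtain ⟨s, j⟩ := i
    have hT := totalGain_mem h0 h1 v s
    have hT' := totalGain_mem h0 h1 (flipAt (s, j) v) s
    have hg := gain_mem h0 h1 true
    simp only [gain, if_true] at hg
    rw [totalGain_flipAt hv] at hT' ⊢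
    have hf : flipAt (s, j) v (s, j) = true := by simp [flipAt, hv]
    have := sq_div_le_sq_sub_sqrt (T := totalGain β v s) (t := Real.exp β - 1) (β := β) (M := m)
      (by exact_mod_cast hm) hT.1 hT'.2 h0 (by linarith [Real.add_one_le_exp β])
      (by linarith [hg.2])
    rw [add_sub_cancel] at this
    simpa [hv, hf, gain] using this
  cases hv : v i
  · rw [← hv]
    exact key v hv
  · have h2 := key (flipAt i v) (by simp [flipAt, hv])
    rw [flipAt_involutive i v] at h2
    rw [← hv, ← neg_sub, neg_sq]
    exact h2

/-! ### The lower bound for a given gap -/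

/-- The data of `n` observations do not identify a single sign: the Bhattacharyya coefficient of two
adjacent instances stays above `1 / 2`. -/
theorem half_le_bhattacharyya {b δ C : ℝ} {n : ℕ} (hm : 0 < m) (hC : 1 ≤ C) (ρ : ContextLaw S)
    (hρ : ∀ s, ρ s = 1 / S) (hb : b ∈ Set.Icc (0 : ℝ) (1 / 4)) (hδ : δ ∈ Set.Icc (0 : ℝ) (1 / 4))
    (hn : n * δ ^ 2 ≤ S * C * m) (i : Fin S × Fin m) (v : Fin S × Fin m → Bool) :
    1 / 2 ≤ ∑ x : Fin n → Fin S × Fin (m + 1) × Bool,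
      √((∏ k, signWeight ρ (hardRef S C hm hC) (hardReward b δ v) (x k))
        * ∏ k, signWeight ρ (hardRef S C hm hC) (hardReward b δ (flipAt i v)) (x k)) := by
  obtain ⟨s, j⟩ := i
  have hr := fun v : Fin S × Fin m → Bool => hardReward_mem hb hδ v
  have hr1 : ∀ (v : Fin S × Fin m → Bool) s a, hardReward b δ v s a ∈ Set.Icc (0 : ℝ) 1 :=
    fun v s a => ⟨(hr v s a).1, (hr v s a).2.trans (by norm_num)⟩
  have hS : (0 : ℝ) < S := by exact_mod_cast s.pos
  have hm0 : (0 : ℝ) < m := by exact_mod_cast hm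
  have hC0 : 0 < C := by linarith
  rw [sum_sqrt_prod_mul_prod (signWeight_nonneg ρ _ (hr1 v))
    (signWeight_nonneg ρ _ (hr1 (flipAt (s, j) v)))]
  have h1 := one_sub_le_sum_sqrt_signWeight ρ (hardRef S C hm hC) (hr v) (hr (flipAt (s, j) v))
    (s₀ := s) (a₀ := j.succ) (by
      intro s' a h
      induction a using Fin.cases with
      | zero => rfl
      | succ j' =>
        have : (s', j') ≠ (s, j) := by
          rintro h'
          simp only [Prod.mk.injEq] at h'
          exact h (by rw [h'.1, h'.2])
        simp [flipAt, Function.update_of_ne this])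
  have hd : (hardReward b δ v s j.succ - hardReward b δ (flipAt (s, j) v) s j.succ) ^ 2
      = δ ^ 2 := by
    cases hv : v (s, j) <;> simp [flipAt, hv]
  rw [hd, hardRef_succ, hρ] at h1
  set w : ℝ := 1 / S * (1 / (C * m)) * (δ ^ 2 / 2) with hw
  have hw1 : w ≤ 1 := by
    have hS1 : (1 : ℝ) ≤ S := by exact_mod_cast s.pos
    have hm1 : (1 : ℝ) ≤ m := by exact_mod_cast hm
    have h2 : 1 / (S : ℝ) ≤ 1 := by rw [div_le_one hS]; exact hS1
    have h3 : 1 / (C * m) ≤ 1 := by rw [div_le_one (by positivity)]; nlinarith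
    have h4 : δ ^ 2 / 2 ≤ 1 := by nlinarith [hδ.1, hδ.2]
    exact mul_le_one₀ (mul_le_one₀ h2 (by positivity) h3) (by positivity) h4
  have hnw : n * w ≤ 1 / 2 := by
    have e : n * w = n * δ ^ 2 / (S * C * m) / 2 := by
      rw [hw]
      field_simp
    have : n * δ ^ 2 / (S * C * m) ≤ 1 := by rwa [div_le_one (by positivity)]
    rw [e]
    linarith
  have h2 := one_add_mul_le_pow (a := -w) (by linarith) n
  have h3 := pow_le_pow_left₀ (by linarith : (0 : ℝ) ≤ 1 - w) h1 n
  rw [← sub_eq_add_neg] at h2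
  linarith

/-- The rate in terms of the gap `δ`, which may be any number so small that the optimal policy
depends on the signs in a controlled way (`η δ ≤ 1 / 2`) and that the data do not reveal them. -/
theorem ofReal_le_minimaxRisk {n : ℕ} {η C δ : ℝ} (ρ : ContextLaw S) (hρ : ∀ s, ρ s = 1 / S)
    (hS : 1 ≤ S) (hm : 2 ≤ m) (hη : 2 ≤ η) (hC : 2 ≤ C) (hCη : C ≤ Real.exp (η / 4)) (hδ : 0 ≤ δ)
    (hηδ : η * δ ≤ 1 / 2) (hn : n * δ ^ 2 ≤ S * C * m) :
    ENNReal.ofReal (η * δ ^ 2 / 1536) ≤ minimaxRisk (m + 1) ρ η C n := by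
  refine le_iInf fun alg => ?_
  have hη0 : 0 < η := by linarith
  have hS0 : (0 : ℝ) < S := by exact_mod_cast hS
  have hm0 : 0 < m := by omega
  have hC1 : 1 ≤ C := by linarith
  have hβ : 0 ≤ η * δ := mul_nonneg hη0.le hδ
  -- `exp (η b) = C - 1` balances the base action against the others: the likelihood ratio of an
  -- action of weight `gain` is then exactly `C` times `gain / (1 + mean of the gains)`.
  obtain ⟨b, hb⟩ : ∃ b, η * b = Real.log (C - 1) := ⟨Real.log (C - 1) / η, by field_simp⟩
  have hb' : b ∈ Set.Icc (0 : ℝ) (1 / 4) := by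
    have h1 : 0 ≤ η * b := hb ▸ Real.log_nonneg (by linarith)
    have h2 : η * b ≤ η * (1 / 4) := by
      rw [hb, Real.log_le_iff_le_exp (by linarith), mul_one_div]
      linarith
    exact ⟨nonneg_of_mul_nonneg_right h1 hη0, le_of_mul_le_mul_left h2 hη0⟩
  have hδ' : δ ∈ Set.Icc (0 : ℝ) (1 / 4) := ⟨hδ, by nlinarith⟩
  have hr : ∀ (v : Fin S × Fin m → Bool) s a, hardReward b δ v s a ∈ Set.Icc (0 : ℝ) 1 :=
    fun v s a => ⟨(hardReward_mem hb' hδ' v s a).1,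
      (hardReward_mem hb' hδ' v s a).2.trans (by norm_num)⟩
  set q := hardRef S C hm0 hC1 with hq
  have := alg.isMarkov q
  have hA := assouad (ι := Fin S × Fin m) (X := Fin n → Fin S × Fin (m + 1) × Bool)
    (Ω := Policy S (m + 1)) (fun x => alg.output q (decode ∘ x))
    (u := fun i π => √(π i.1 i.2.succ)) (fun i => ((measurable_pi_apply i.2.succ).comp
      (measurable_subtype_coe.comp (measurable_pi_apply i.1))).sqrt)
    (P := fun v x => ∏ k, signWeight ρ q (hardReward b δ v) (x k))
    (fun v x => Finset.prod_nonneg fun k _ => signWeight_nonneg ρ q (hr v) _)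
    (fun v => by
      rw [← Fintype.sum_pow fun x => signWeight ρ q (hardReward b δ v) x, sum_signWeight, one_pow])
    (α := fun i v => √(gain (η * δ) (v i) / totalGain (η * δ) v i.1))
    (Δ := (η * δ) ^ 2 / (48 * m)) (h := 1 / 2) (by positivity) (by norm_num)
    (fun i v => separation hβ hηδ hm i v)
    (fun i v => half_le_bhattacharyya hm0 hC1 ρ hρ hb' hδ' hn i v)
  -- `L v` is the expected squared Hellinger loss on the instance `v`, without the base action.
  set L : (Fin S × Fin m → Bool) → ℝ≥0∞ := fun v =>
    ∑ x : Fin n → Fin S × Fin (m + 1) × Bool,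
      ENNReal.ofReal (∏ k, signWeight ρ q (hardReward b δ v) (x k)) *
      ∫⁻ π, ENNReal.ofReal (∑ i : Fin S × Fin m, (√(π i.1 i.2.succ)
        - √(gain (η * δ) (v i) / totalGain (η * δ) v i.1)) ^ 2) ∂alg.output q (decode ∘ x) with hL
  have hrisk : ∀ v, ENNReal.ofReal (η⁻¹ * (1 / S)) * L v
      ≤ risk ρ η (signInstance q (hardReward b δ v) (hr v)) alg := by
    intro v
    refine le_trans ?_ (sum_le_risk_signInstance ρ q (hr v) η alg)
    rw [hL, Finset.mul_sum]
    refine Finset.sum_le_sum fun x _ => ?_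
    rw [mul_left_comm, ← lintegral_const_mul' _ _ ENNReal.ofReal_ne_top]
    gcongr with π
    refine le_trans ?_ (ofReal_hellinger_le_subOpt ρ hη0 _
      (fun s a => hardRef_pos hm0 (by linarith) s a) π)
    rw [← ENNReal.ofReal_mul (by positivity), mul_assoc]
    refine ENNReal.ofReal_le_ofReal (mul_le_mul_of_nonneg_left ?_ (by positivity))
    rw [Fintype.sum_prod_type, Finset.mul_sum]
    refine Finset.sum_le_sum fun s _ => ?_
    rw [hρ, Fin.sum_univ_succ]
    refine mul_le_mul_of_nonneg_left ?_ (by positivity)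
    simp only [hq, optimalPolicy_hard_succ hm0 hC hb]
    exact le_add_of_nonneg_left (sq_nonneg _)
  have hsup : ∀ v, ENNReal.ofReal (η⁻¹ * (1 / S)) * L v
      ≤ ⨆ I ∈ MAB S (m + 1) η C, risk ρ η I alg := fun v =>
    (hrisk v).trans (le_iSup₂ (f := fun I (_ : I ∈ MAB S (m + 1) η C) => risk ρ η I alg) _
      (signInstance_hard_mem_MAB hm0 hC hb v (hr v) hβ hηδ))
  -- The worst case is at least the average over all sign vectors.
  have hsum := Finset.sum_le_sum fun v (_ : v ∈ Finset.univ) => hsup v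
  rw [← Finset.mul_sum, Finset.sum_const, Finset.card_univ, nsmul_eq_mul] at hsum
  have hall := (mul_le_mul_right hA (ENNReal.ofReal (η⁻¹ * (1 / S)))).trans hsum
  have e : η⁻¹ * (1 / S) * ((Fintype.card (Fin S × Fin m → Bool) : ℝ)
      * (Fintype.card (Fin S × Fin m) * ((η * δ) ^ 2 / (48 * m) * (1 / 2) ^ 2 / 8)))
      = (Fintype.card (Fin S × Fin m → Bool) : ℝ) * (η * δ ^ 2 / 1536) := by
    rw [Fintype.card_prod, Fintype.card_fin, Fintype.card_fin]
    push_cast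
    field_simp
    ring
  rw [← ENNReal.ofReal_mul (by positivity), e, ENNReal.ofReal_mul (by positivity),
    ENNReal.ofReal_natCast] at hall
  exact (ENNReal.mul_le_mul_iff_right (by simp)
    (ENNReal.natCast_ne_top _)).1 hall

end KLBandit

theorem mainTheorem2 :
    ∀ K : ℝ, 0 < K → ∃ c : ℝ, 0 < c ∧
      ∀ (S A n : ℕ) (η Cstar : ℝ) (ρ : KLBandit.ContextLaw S),
        1 ≤ S → 3 ≤ A → 4 * Real.log 2 < η → 2 < Cstar → Cstar ≤ Real.exp (η / 4) →
        η ^ 2 ≤ K * (n * Real.log A / (S * A * Cstar)) →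
        (∀ s, ρ s = 1 / S) →
          ENNReal.ofReal (c * (η * S * A * Cstar / (n * Real.log A)))
            ≤ KLBandit.minimaxRisk A ρ η Cstar n := by
  intro K hK
  -- The squared gap is `κ S A C / (n log A)`: `κ ≤ 1 / 2` hides the signs from the data, and
  -- `κ ≤ 1 / (4 K)` turns the regularization assumption into `η δ ≤ 1 / 2`.
  obtain ⟨κ, hκ0, hκ1, hκK⟩ : ∃ κ : ℝ, 0 < κ ∧ κ ≤ 1 / 2 ∧ κ * K ≤ 1 / 4 := by
    refine ⟨min (1 / 2) (1 / (4 * K)), by positivity, min_le_left _ _, ?_⟩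
    calc min (1 / 2) (1 / (4 * K)) * K ≤ 1 / (4 * K) * K :=
          mul_le_mul_of_nonneg_right (min_le_right _ _) hK.le
      _ = 1 / 4 := by field_simp
  refine ⟨κ / 1536, by positivity, ?_⟩
  intro S A n η C ρ hS hA hη hC hCη hreg hρ
  obtain ⟨m, rfl⟩ : ∃ m, A = m + 1 := ⟨A - 1, by omega⟩
  have hm : 2 ≤ m := by omega
  have hη2 : 2 ≤ η := by linarith [Real.log_two_gt_d9]
  have hS0 : (0 : ℝ) < S := by exact_mod_cast hS
  have hm2 : (2 : ℝ) ≤ m := by exact_mod_cast hm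
  have hlog : 1 ≤ Real.log ((m + 1 : ℕ) : ℝ) := by
    rw [Real.le_log_iff_exp_le (by positivity)]
    push_cast
    linarith [Real.exp_one_lt_d9]
  have hn : (0 : ℝ) < n := by
    rcases Nat.eq_zero_or_pos n with rfl | h
    · simp only [Nat.cast_zero, zero_mul, zero_div, mul_zero] at hreg
      nlinarith
    · exact_mod_cast h
  set l := Real.log ((m + 1 : ℕ) : ℝ)
  set D : ℝ := κ * (S * (m + 1 : ℕ) * C / (n * l)) with hD
  have hD0 : 0 ≤ D := by positivity
  have hsq : √D ^ 2 = D := Real.sq_sqrt hD0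
  have hηδ : η * √D ≤ 1 / 2 := by
    refine abs_le_of_sq_le_sq' ?_ (by norm_num) |>.2
    rw [mul_pow, hsq]
    calc η ^ 2 * D ≤ K * (n * l / (S * (m + 1 : ℕ) * C)) * D :=
          mul_le_mul_of_nonneg_right hreg hD0
      _ = κ * K := by
          rw [hD]
          field_simp
      _ ≤ (1 / 2) ^ 2 := by linarith
  have hnD : n * √D ^ 2 ≤ S * C * m := by
    have e : n * √D ^ 2 = S * C * (κ * (m + 1 : ℕ) / l) := by
      rw [hsq, hD]
      field_simp
    rw [e]
    refine mul_le_mul_of_nonneg_left ?_ (by positivity)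
    rw [div_le_iff₀ (by linarith)]
    push_cast
    nlinarith
  refine le_trans (le_of_eq ?_) (KLBandit.ofReal_le_minimaxRisk ρ hρ hS hm hη2 hC.le hCη
    (Real.sqrt_nonneg D) hηδ hnD)
  rw [hsq, hD]
  congr 1
  ring
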